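/- Let $n\ge 1$, $m,l_1,l_2,l\ge 0$ be integers and $t_0,t_1\in\mathbb R$. For $t\in[t_0,t_1]$ let $g(t,\cdot,\cdot):\mathbb R^n\times\mathbb R^m\to\mathbb R^{l_1}$, $h(t,\cdot,\cdot):\mathbb R^n\times\mathbb R^m\to\mathbb R^{l_2}$ and $G(t,\cdot,\cdot),H(t,\cdot,\cdot):\mathbb R^n\times\mathbb R^m\to\mathbb R^{l}$ be strictly differentiable at every point, and let $U(t)\subseteq\mathbb R^m$ be closed. All norms are Euclidean. Put $\mathcal C^l=\{(a,b)\in\mathbb R^l\times\mathbb R^l: a\ge 0,\ b\ge 0,\ \langle a,b\rangle=0\}$ and $$S(t)=\{(x,u)\in\mathbb R^n\times U(t): g(t,x,u)\le 0,\ h(t,x,u)=0,\ (G(t,x,u),H(t,x,u))\in\mathcal C^l\}.$$ Given functions $x^*:[t_0,t_1]\to\mathbb R^n$, $u^*:[t_0,t_1]\to\mathbb R^m$, $R:[t_0,t_1]\to[0,+\infty]$ and $\varepsilon\in\mathbb R$, let $$S_*^{\varepsilon,R}(t)=\{(x,u)\in S(t): \|x-x^*(t)\|\le\varepsilon,\ \|u-u^*(t)\|\le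 R(t)\}.$$ For a set $\Omega$ and $z\in{\rm cl}\,\Omega$, the proximal normal cone $\mathcal N^P_\Omega(z)$ is the set of all $v$ for which some $\sigma\ge 0$ satisfies $\langle v,y-z\rangle\le\sigma\|y-z\|^2$ for all $y\in\Omega$. The limiting normal cone $\mathcal N^L_\Omega(z)$ is the set of limits of sequences $v^k\in\mathcal N^P_\Omega(z^k)$ with $z^k\in{\rm cl}\,\Omega$, $z^k\to z$. Let $$\Psi(t,x,u;\lambda,\upsilon,\mu,\nu)=g(t,x,u)^\top\lambda+h(t,x,u)^\top\upsilon-G(t,x,u)^\top\mu-H(t,x,u)^\top\nu .$$ Assume the following. (A) There are measurable functions $k_x^g,k_x^h,k_x^G,k_x^H:[t_0,t_1]\to\mathbb R$ such that for almost every $t\in[t_0,t_1]$ and every $(x,u)\in S_*^{\varepsilon,R}(t)$ there is $\delta>0$ such that for all $x_1,x_2$ with $\|x_1-x\|<\delta$ and $\|x_2-x\|<\delta$, $$\|g(t,x_1,u)-g(t,x_2,u)\|\le k_x^g(t)\|x_1-x_2\|,$$ and likewise for $h,G,H$ with $k_x^h,k_x^G,k_x^H$. (B) There is a measurable function $\kappa:[t_0,t_1]\to\mathbb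 R$ such that for almost every $t\in[t_0,t_1]$, for all $(x,u)\in S_*^{\varepsilon,R}(t)$, all $\zeta\in\mathcal N^L_{U(t)}(u)$ and all $(\lambda,\upsilon,\mu,\nu)\in\mathbb R^{l_1}\times\mathbb R^{l_2}\times\mathbb R^l\times\mathbb R^l$ with $\lambda\ge 0$; $\lambda_i=0$ if $g_i(t,x,u)<0$; $\mu_i=0$ if $G_i(t,x,u)>0=H_i(t,x,u)$; $\nu_i=0$ if $G_i(t,x,u)=0<H_i(t,x,u)$; and ($\mu_i>0$ and $\nu_i>0$) or $\mu_i\nu_i=0$ if $G_i(t,x,u)=H_i(t,x,u)=0$, one has $$\|(\lambda,\upsilon,\mu,\nu)\|\le\kappa(t)\,\|\nabla_u\Psi(t,x,u;\lambda,\upsilon,\mu,\nu)+\zeta\| .$$ Then the following hold for almost every $t\in[t_0,t_1]$. (1) The local error bound condition for the system defining $S(t)$ holds at every $(\bar x,\bar u)\in S_*^{\varepsilon,R}(t)$: there are $\tau>0$ and $\delta>0$ such that for all $(x,u)\in\mathbb R^n\times U(t)$ with $\|(x,u)-(\bar x,\bar u)\|<\delta$, $${\rm dist}_{S(t)}(x,u)\le\tau\big(\|g(t,x,u)_+\|+\|h(t,x,u)\|+{\rm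 dist}_{\mathcal C^l}(G(t,x,u),H(t,x,u))\big),$$ where $a_+$ is the componentwise maximum of $a$ and $0$. (2) The bounded slope condition holds with $k_S(t)=\kappa(t)\,(k_x^g(t)+k_x^h(t)+k_x^G(t)+k_x^H(t))$, which is a measurable function: if $(x,u)\in S_*^{\varepsilon,R}(t)$ and $(\alpha,\beta)\in\mathcal N^P_{S(t)}(x,u)$, then $\|\alpha\|\le k_S(t)\|\beta\|$. -/

import Mathlib

open MeasureTheory Filter Topology
open scoped ENNReal RealInnerProductSpace

/-- `ℝᵈ` with its Euclidean norm. -/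
abbrev Eucl (d : ℕ) : Type := EuclideanSpace ℝ (Fin d)

/-- `ℝᵖ × ℝ^q` with its Euclidean norm (the Hilbert product, not the sup-norm product). -/
abbrev EuclProd (p q : ℕ) : Type := WithLp 2 (Eucl p × Eucl q)

section NormalCones

variable {E : Type*} [NormedAddCommGroup E] [InnerProductSpace ℝ E]

/-- The proximal normal cone to `Ω` at `x`; it is empty when `x ∉ cl Ω`. -/
def proximalNormalCone (Ω : Set E) (x : E) : Set E :=
  {v | x ∈ closure Ω ∧ ∃ σ : ℝ, 0 ≤ σ ∧ ∀ y ∈ Ω, ⟪v, y - x⟫ ≤ σ * ‖y - x‖ ^ 2}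

/-- The limiting normal cone to `Ω` at `x`. -/
def limitingNormalCone (Ω : Set E) (x : E) : Set E :=
  {v | ∃ (xs : ℕ → E) (vs : ℕ → E), Tendsto xs atTop (𝓝 x) ∧ Tendsto vs atTop (𝓝 v) ∧
    ∀ k, vs k ∈ proximalNormalCone Ω (xs k)}

end NormalCones

/-- The complementarity cone `{(a, b) : 0 ≤ a ⊥ b ≥ 0}` in `ℝˡ × ℝˡ`. -/
def complementarityCone (l : ℕ) : Set (EuclProd l l) :=
  {c | (∀ i, 0 ≤ c.fst i) ∧ (∀ i, 0 ≤ c.snd i) ∧ ⟪c.fst, c.snd⟫ = 0}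

/-- The componentwise nonnegative part of a vector. -/
noncomputable def posPartVec {d : ℕ} (a : Eucl d) : Eucl d :=
  WithLp.toLp 2 fun i => max (a i) 0

section ConstrainedSystem

variable {Z : Type*} [PseudoMetricSpace Z] {l₁ l₂ l : ℕ}

/-- The solution set of `z ∈ D`, `g z ≤ 0`, `h z = 0`, `(G z, H z) ∈ complementarityCone l`. -/
def systemSet (D : Set Z) (g : Z → Eucl l₁) (h : Z → Eucl l₂) (G H : Z → Eucl l) : Set Z :=
  {z | z ∈ D ∧ (∀ i, g z i ≤ 0) ∧ h z = 0 ∧ WithLp.toLp 2 (G z, H z) ∈ complementarityCone l}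

/-- The local error bound condition at `zbar`, a point of the solution set, for the constrained
system given by `D, g, h, G, H`. -/
def LocalErrorBound (D : Set Z) (g : Z → Eucl l₁) (h : Z → Eucl l₂) (G H : Z → Eucl l)
    (zbar : Z) : Prop :=
  zbar ∈ systemSet D g h G H ∧
  ∃ τ : ℝ, 0 < τ ∧ ∃ δ : ℝ, 0 < δ ∧ ∀ z ∈ Metric.ball zbar δ ∩ D,
    Metric.infDist z (systemSet D g h G H) ≤
      τ * (‖posPartVec (g z)‖ + ‖h z‖ +
        Metric.infDist (WithLp.toLp 2 (G z, H z)) (complementarityCone l))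

end ConstrainedSystem

/-- The data of the mixed constraints of an optimal control problem with equilibrium constraints:
`g(t,x,u) ≤ 0`, `h(t,x,u) = 0`, `0 ≤ G(t,x,u) ⊥ H(t,x,u) ≥ 0`, `u ∈ U(t)`. -/
structure MixedConstraints (n m l₁ l₂ l : ℕ) where
  g : ℝ → Eucl n → Eucl m → Eucl l₁
  h : ℝ → Eucl n → Eucl m → Eucl l₂
  G : ℝ → Eucl n → Eucl m → Eucl l
  H : ℝ → Eucl n → Eucl m → Eucl l
  U : ℝ → Set (Eucl m)

/-- A map `f(x,u)` viewed as a map on the Euclidean product. -/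
def onPairs {n m d : ℕ} (f : Eucl n → Eucl m → Eucl d) : EuclProd n m → Eucl d :=
  fun z => f z.fst z.snd

/-- `f` is strictly differentiable in `(x,u)` at every point. -/
def StrictlyDifferentiable {n m d : ℕ} (f : Eucl n → Eucl m → Eucl d) : Prop :=
  ∀ z : EuclProd n m, ∃ f' : EuclProd n m →L[ℝ] Eucl d, HasStrictFDerivAt (onPairs f) f' z

namespace MixedConstraints

variable {n m l₁ l₂ l : ℕ} (P : MixedConstraints n m l₁ l₂ l)

/-- `ℝⁿ × U(t)`. -/
def D (t : ℝ) : Set (EuclProd n m) := {z | z.snd ∈ P.U t}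

/-- The mixed constraint set `S(t)`. -/
def S (t : ℝ) : Set (EuclProd n m) :=
  systemSet (P.D t) (onPairs (P.g t)) (onPairs (P.h t)) (onPairs (P.G t)) (onPairs (P.H t))

/-- The part of `S(t)` with `‖x - xs(t)‖ ≤ ε` and `‖u - us(t)‖ ≤ R(t)`, where `R(t)` may be
infinite. -/
def SStar (xs : ℝ → Eucl n) (us : ℝ → Eucl m) (ε : ℝ) (R : ℝ → ℝ≥0∞) (t : ℝ) :
    Set (EuclProd n m) :=
  {z | z ∈ P.S t ∧ ‖z.fst - xs t‖ ≤ ε ∧ ‖z.snd - us t‖ₑ ≤ R t}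

/-- `Ψ(t,x,u;lam,ups,mu,nu) = gᵀ lam + hᵀ ups - Gᵀ mu - Hᵀ nu`. -/
noncomputable def Psi (t : ℝ) (x : Eucl n) (u : Eucl m)
    (lam : Eucl l₁) (ups : Eucl l₂) (mu nu : Eucl l) : ℝ :=
  ⟪P.g t x u, lam⟫ + ⟪P.h t x u, ups⟫ - ⟪P.G t x u, mu⟫ - ⟪P.H t x u, nu⟫

/-- `∇ᵤ Ψ(t,x,u;lam,ups,mu,nu)`. -/
noncomputable def gradUPsi (t : ℝ) (x : Eucl n) (u : Eucl m)
    (lam : Eucl l₁) (ups : Eucl l₂) (mu nu : Eucl l) : Eucl m :=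
  gradient (fun v => P.Psi t x v lam ups mu nu) u

/-- The sign and complementarity conditions on the multipliers at `(t,x,u)`. The multiplier of
the equality constraint is free. -/
structure AdmissibleMultipliers (t : ℝ) (x : Eucl n) (u : Eucl m)
    (lam : Eucl l₁) (mu nu : Eucl l) : Prop where
  lam_nonneg : ∀ i, 0 ≤ lam i
  lam_inactive : ∀ i, P.g t x u i < 0 → lam i = 0
  mu_eq_zero : ∀ i, 0 < P.G t x u i → P.H t x u i = 0 → mu i = 0
  nu_eq_zero : ∀ i, P.G t x u i = 0 → 0 < P.H t x u i → nu i = 0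
  degenerate : ∀ i, P.G t x u i = 0 → P.H t x u i = 0 → (0 < mu i ∧ 0 < nu i) ∨ mu i * nu i = 0

/-- The local error bound condition for the system representing `S(t)`. -/
def ErrorBoundAt (t : ℝ) (z : EuclProd n m) : Prop :=
  LocalErrorBound (P.D t) (onPairs (P.g t)) (onPairs (P.h t)) (onPairs (P.G t)) (onPairs (P.H t)) z

/-- The multiplier bound with function `κ`, for almost every `t ∈ [t₀,t₁]`. -/
def MultiplierBound (t₀ t₁ : ℝ) (xs : ℝ → Eucl n) (us : ℝ → Eucl m) (ε : ℝ) (R : ℝ → ℝ≥0∞)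
    (κ : ℝ → ℝ) : Prop :=
  ∀ᵐ t ∂volume.restrict (Set.Icc t₀ t₁), ∀ (x : Eucl n) (u : Eucl m),
    WithLp.toLp 2 (x, u) ∈ P.SStar xs us ε R t →
    ∀ ζ ∈ limitingNormalCone (P.U t) u,
    ∀ (lam : Eucl l₁) (ups : Eucl l₂) (mu nu : Eucl l),
    P.AdmissibleMultipliers t x u lam mu nu →
      √(‖lam‖ ^ 2 + ‖ups‖ ^ 2 + ‖mu‖ ^ 2 + ‖nu‖ ^ 2) ≤
        κ t * ‖P.gradUPsi t x u lam ups mu nu + ζ‖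

/-- For almost every `t ∈ [t₀,t₁]`, for every `(x,u)` in the localized constraint set, `f(t,·,u)`
is Lipschitz with constant `k(t)` on a neighbourhood of `x`. -/
def LipschitzInX {d : ℕ} (f : ℝ → Eucl n → Eucl m → Eucl d) (t₀ t₁ : ℝ)
    (xs : ℝ → Eucl n) (us : ℝ → Eucl m) (ε : ℝ) (R : ℝ → ℝ≥0∞) (k : ℝ → ℝ) : Prop :=
  ∀ᵐ t ∂volume.restrict (Set.Icc t₀ t₁), ∀ (x : Eucl n) (u : Eucl m),
    WithLp.toLp 2 (x, u) ∈ P.SStar xs us ε R t →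
    ∃ δ : ℝ, 0 < δ ∧ ∀ x₁ ∈ Metric.ball x δ, ∀ x₂ ∈ Metric.ball x δ,
      ‖f t x₁ u - f t x₂ u‖ ≤ k t * ‖x₁ - x₂‖

/-- The bounded slope condition with function `kS`, for almost every `t ∈ [t₀,t₁]`. -/
def BoundedSlope (t₀ t₁ : ℝ) (xs : ℝ → Eucl n) (us : ℝ → Eucl m) (ε : ℝ) (R : ℝ → ℝ≥0∞)
    (kS : ℝ → ℝ) : Prop :=
  ∀ᵐ t ∂volume.restrict (Set.Icc t₀ t₁), ∀ z ∈ P.SStar xs us ε R t,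
    ∀ (α : Eucl n) (β : Eucl m), WithLp.toLp 2 (α, β) ∈ proximalNormalCone (P.S t) z →
      ‖α‖ ≤ kS t * ‖β‖

end MixedConstraints

/-! At a fixed time, stack the four constraint maps into F and write S = D ∩ F⁻¹(K), where D = ℝⁿ ×
U and K is the product of the nonpositive orthant, {0} and the complementarity cone. With A the
derivative of F at z, call p a multiplier for a if p is a limiting normal to K at F(z) and a - A*p
is a limiting normal to D.

Normals to K satisfy, up to sign, the conditions in (B), and normals to D have zero x-part. Hence
(B) says: if p is a multiplier for a, then a and A*p have the same x-part and ‖p‖ ≤ κ‖a_u‖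
(`norm_le_of_multiplierBound`). With a = 0 this is a qualification condition: only p = 0 is a
multiplier for 0.

Under that condition the error bound follows by contradiction: violating points are perturbed to
points carrying unit normals p, whose limit is a nonzero multiplier for 0 (`exists_errorBound`).
Separately, penalization shows that every proximal normal to S has a multiplier
(`exists_multiplier_of_mem_proximalNormalCone`). For the normal (α, β) this gives α = (A*p)_x and
‖p‖ ≤ κ‖β‖, while the Lipschitz constants in x bound ‖(A*p)_x‖ by their sum times ‖p‖. -/

section NormalConeCalculus

/-! ### Proximal and limiting normals. -/

variable {E : Type*} [NormedAddCommGroup E] [InnerProductSpace ℝ E]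

/-- The ε-form replaces diagonal extraction of sequences by a triangle inequality. -/
theorem mem_limitingNormalCone_iff {Ω : Set E} {x v : E} :
    v ∈ limitingNormalCone Ω x ↔
      ∀ ε > 0, ∃ x' v', dist x' x < ε ∧ dist v' v < ε ∧ v' ∈ proximalNormalCone Ω x' := by
  constructor
  · rintro ⟨xs, vs, hx, hv, h⟩ ε hε
    obtain ⟨k, hk₁, hk₂⟩ := ((Metric.tendsto_nhds.1 hx ε hε).and
      (Metric.tendsto_nhds.1 hv ε hε)).exists
    exact ⟨xs k, vs k, hk₁, hk₂, h k⟩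
  · intro h
    choose! xs vs hx hv hP using h
    have hpos : ∀ k : ℕ, (0 : ℝ) < 1 / ((k : ℝ) + 1) := fun k => Nat.one_div_pos_of_nat
    refine ⟨fun k => xs (1 / ((k : ℝ) + 1)), fun k => vs (1 / ((k : ℝ) + 1)), ?_, ?_,
      fun k => hP _ (hpos k)⟩
    · exact tendsto_iff_dist_tendsto_zero.2 (squeeze_zero (fun _ => dist_nonneg)
        (fun k => (hx _ (hpos k)).le) tendsto_one_div_add_atTop_nhds_zero_nat)
    · exact tendsto_iff_dist_tendsto_zero.2 (squeeze_zero (fun _ => dist_nonneg)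
        (fun k => (hv _ (hpos k)).le) tendsto_one_div_add_atTop_nhds_zero_nat)

theorem proximalNormalCone_subset_limitingNormalCone (Ω : Set E) (x : E) :
    proximalNormalCone Ω x ⊆ limitingNormalCone Ω x := fun v hv =>
  ⟨fun _ => x, fun _ => v, tendsto_const_nhds, tendsto_const_nhds, fun _ => hv⟩

/-- The graph of the limiting normal cone is closed. -/
theorem mem_limitingNormalCone_of_tendsto {Ω : Set E} {xs vs : ℕ → E} {x v : E}
    (hx : Tendsto xs atTop (𝓝 x)) (hv : Tendsto vs atTop (𝓝 v))
    (h : ∀ k, vs k ∈ limitingNormalCone Ω (xs k)) : v ∈ limitingNormalCone Ω x := by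
  rw [mem_limitingNormalCone_iff]
  intro ε hε
  obtain ⟨k, hk₁, hk₂⟩ := ((Metric.tendsto_nhds.1 hx (ε / 2) (half_pos hε)).and
    (Metric.tendsto_nhds.1 hv (ε / 2) (half_pos hε))).exists
  obtain ⟨x', v', h₁, h₂, h₃⟩ := mem_limitingNormalCone_iff.1 (h k) (ε / 2) (half_pos hε)
  exact ⟨x', v', by linarith [dist_triangle x' (xs k) x], by linarith [dist_triangle v' (vs k) v],
    h₃⟩

theorem smul_mem_proximalNormalCone {Ω : Set E} {x v : E} (hv : v ∈ proximalNormalCone Ω x)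
    {c : ℝ} (hc : 0 ≤ c) : c • v ∈ proximalNormalCone Ω x := by
  obtain ⟨hx, σ, hσ, h⟩ := hv
  refine ⟨hx, c * σ, by positivity, fun y hy => ?_⟩
  rw [real_inner_smul_left, mul_assoc]
  exact mul_le_mul_of_nonneg_left (h y hy) hc

theorem smul_mem_limitingNormalCone {Ω : Set E} {x v : E} (hv : v ∈ limitingNormalCone Ω x)
    {c : ℝ} (hc : 0 ≤ c) : c • v ∈ limitingNormalCone Ω x := by
  obtain ⟨xs, vs, hx, hv, h⟩ := hv
  exact ⟨xs, fun k => c • vs k, hx, hv.const_smul c,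
    fun k => smul_mem_proximalNormalCone (h k) hc⟩

/-- Squaring ‖q - p‖ ≤ ‖q - y‖ and expanding around p gives the proximal inequality with σ = 1/2. -/
theorem sub_mem_proximalNormalCone_of_infDist_eq {Ω : Set E} {q p : E} (hp : p ∈ Ω)
    (h : Metric.infDist q Ω = dist q p) : q - p ∈ proximalNormalCone Ω p := by
  refine ⟨subset_closure hp, 1 / 2, by norm_num, fun y hy => ?_⟩
  have h₁ : ‖q - p‖ ≤ ‖(q - p) - (y - p)‖ := by
    rw [sub_sub_sub_cancel_right, ← dist_eq_norm, ← dist_eq_norm, ← h]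
    exact Metric.infDist_le_dist_of_mem hy
  have h₂ := pow_le_pow_left₀ (norm_nonneg _) h₁ 2
  rw [norm_sub_sq_real (q - p)] at h₂
  linarith

section FiniteDimensional

variable [FiniteDimensional ℝ E]

/-- A Fréchet normal vector to a closed set is a limiting normal vector. -/
theorem mem_limitingNormalCone_of_frechet {Ω : Set E} (hΩ : IsClosed Ω) {x v : E} (hx : x ∈ Ω)
    (h : ∀ c > 0, ∀ᶠ z in 𝓝[Ω] x, ⟪v, z - x⟫ ≤ c * ‖z - x‖) : v ∈ limitingNormalCone Ω x := by
  rw [mem_limitingNormalCone_iff]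
  intro ε hε
  obtain ⟨r, hr, hball⟩ := Metric.mem_nhdsWithin_iff.1 (h (ε / 4) (by positivity))
  obtain ⟨t, ht, htr⟩ : ∃ t > 0, 2 * t * (‖v‖ + 1) < min r ε := by
    refine ⟨min r ε / (4 * (‖v‖ + 1)), by positivity, ?_⟩
    have : 0 < min r ε := by positivity
    have h1 : 2 * (min r ε / (4 * (‖v‖ + 1))) * (‖v‖ + 1) = min r ε / 2 := by
      field_simp; norm_num
    linarith
  -- Project x + tv to p. Then ‖p - x‖² ≤ 2t⟪v, p - x⟫, so the Fréchet inequality forces ‖p - x‖ ≤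
  -- tε/2, and the proximal normal (x + tv - p)/t is ε-close to v.
  obtain ⟨p, hp, hpd⟩ := hΩ.exists_infDist_eq_dist ⟨x, hx⟩ (x + t • v)
  have hle : ‖t • v - (p - x)‖ ≤ ‖t • v‖ := by
    have h1 : dist (x + t • v) p ≤ dist (x + t • v) x :=
      hpd ▸ Metric.infDist_le_dist_of_mem hx
    rw [dist_eq_norm, dist_eq_norm] at h1
    rwa [add_sub_cancel_left, show x + t • v - p = t • v - (p - x) by abel] at h1
  have htv : ‖t • v‖ = t * ‖v‖ := by rw [norm_smul, Real.norm_of_nonneg ht.le]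
  have hpx : ‖p - x‖ ≤ 2 * t * ‖v‖ := by
    have := norm_sub_norm_le (p - x) (t • v)
    rw [norm_sub_rev (p - x)] at this
    linarith
  have hpx' : dist p x < min r ε := by
    rw [dist_eq_norm]; nlinarith
  have hin : ⟪v, p - x⟫ ≤ ε / 4 * ‖p - x‖ :=
    hball ⟨lt_of_lt_of_le hpx' (min_le_left _ _), hp⟩
  have hsq := pow_le_pow_left₀ (norm_nonneg _) hle 2
  rw [norm_sub_sq_real, real_inner_smul_left] at hsq
  have hfin : ‖p - x‖ ≤ t * (ε / 2) := by
    rcases (norm_nonneg (p - x)).eq_or_lt with h0 | h0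
    · rw [← h0]; positivity
    · have h2 : ‖p - x‖ * ‖p - x‖ ≤ t * (ε / 2) * ‖p - x‖ := by nlinarith
      exact le_of_mul_le_mul_right h2 h0
  refine ⟨p, t⁻¹ • (x + t • v - p), lt_of_lt_of_le hpx' (min_le_right _ _), ?_,
    smul_mem_proximalNormalCone (sub_mem_proximalNormalCone_of_infDist_eq hp hpd) (by positivity)⟩
  have h3 : t⁻¹ • (x + t • v - p) - v = -(t⁻¹ • (p - x)) := by
    have : t⁻¹ • (t • v) = v := inv_smul_smul₀ ht.ne' v
    rw [smul_sub, smul_add, this, smul_sub]; abel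
  rw [dist_eq_norm, h3, norm_neg, norm_smul, Real.norm_of_nonneg (by positivity),
    inv_mul_lt_iff₀ ht]
  nlinarith

/-- First order necessary condition for a local minimizer over a closed set. -/
theorem neg_mem_limitingNormalCone_of_isLocalMinOn {Ω : Set E} (hΩ : IsClosed Ω) {φ : E → ℝ}
    {x a : E} (hx : x ∈ Ω) (hmin : IsLocalMinOn φ Ω x) (ha : HasGradientAt φ a x) :
    -a ∈ limitingNormalCone Ω x := by
  refine mem_limitingNormalCone_of_frechet hΩ hx fun c hc => ?_
  have ho := (hasGradientAt_iff_isLittleO.1 ha).def hc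
  filter_upwards [hmin, mem_nhdsWithin_of_mem_nhds ho] with z hz hzo
  have := (abs_le.1 (Real.norm_eq_abs _ ▸ hzo)).2
  have := (abs_le.1 (Real.norm_eq_abs _ ▸ hzo)).1
  rw [inner_neg_left]
  linarith

end FiniteDimensional

end NormalConeCalculus

/-- A map that is strictly differentiable everywhere is continuously differentiable. -/
theorem continuous_of_hasStrictFDerivAt {E W : Type*} [NormedAddCommGroup E] [NormedSpace ℝ E]
    [NormedAddCommGroup W] [NormedSpace ℝ W] {F : E → W} {F' : E → E →L[ℝ] W}
    (hF : ∀ z, HasStrictFDerivAt F (F' z) z) : Continuous F' := by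
  refine continuous_iff_continuousAt.2 fun z => Metric.tendsto_nhds.2 fun ε hε => ?_
  have hc : (0 : ℝ) < ε / 2 := half_pos hε
  obtain ⟨s, hs, t, ht, hst⟩ := mem_nhds_prod_iff.1 ((hF z).isLittleO.def hc)
  filter_upwards [eventually_mem_nhds_iff.2 (inter_mem hs ht)] with y hy
  -- Strict differentiability makes F - F'(z) Lipschitz with constant ε/2 near z, which bounds its
  -- derivative F'(y) - F'(z) at y.
  have hd : HasFDerivAt (fun w => F w - F' z w) (F' y - F' z) y :=
    (hF y).hasFDerivAt.sub (F' z).hasFDerivAt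
  have : ‖F' y - F' z‖ ≤ ε / 2 := by
    refine hd.le_of_lip' hc.le ?_
    filter_upwards [hy] with w hw
    have h1 := hst (Set.mk_mem_prod hw.1 (mem_of_mem_nhds hy).2)
    have h2 : F w - F' z w - (F y - F' z y) = F w - F y - F' z (w - y) := by
      rw [map_sub]; abel
    rw [h2]
    exact h1
  rw [dist_eq_norm]
  linarith

/-! ### Error bound and multiplier rule for z ∈ D, F z ∈ K. -/

section ConstraintSystems

variable {E W : Type*} [NormedAddCommGroup E] [InnerProductSpace ℝ E] [FiniteDimensional ℝ E]
  [NormedAddCommGroup W] [InnerProductSpace ℝ W] [FiniteDimensional ℝ W]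

open ContinuousLinearMap (adjoint)

/-- Optimality condition for a smooth function plus a quadratic penalty of `F z ∈ K`. -/
theorem penalized_normal {D : Set E} (hD : IsClosed D) {F : E → W} {A : E →L[ℝ] W} {w : E}
    (hF : HasFDerivAt F A w) (hw : w ∈ D) (y : W) (c : ℝ) {ψ : E → ℝ} {a : E}
    (hψ : HasGradientAt ψ a w)
    (hmin : IsLocalMinOn (fun z => ψ z + c / 2 * ‖F z - y‖ ^ 2) D w) :
    -a - adjoint A (c • (F w - y)) ∈ limitingNormalCone D w := by
  have h1 : HasFDerivAt (fun z => ψ z + c / 2 * ‖F z - y‖ ^ 2)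
      (InnerProductSpace.toDual ℝ E (a + adjoint A (c • (F w - y)))) w := by
    have := hψ.hasFDerivAt.add (((hF.sub_const y).norm_sq).const_mul (c / 2))
    refine this.congr_fderiv ?_
    ext v
    simp [ContinuousLinearMap.adjoint_inner_left]
    ring
  have := neg_mem_limitingNormalCone_of_isLocalMinOn hD hw hmin h1
  rwa [neg_add'] at this

theorem hasGradientAt_norm_sub_sq (c : ℝ) (z w : E) :
    HasGradientAt (fun x => c * ‖x - z‖ ^ 2) ((2 * c) • (w - z)) w := by
  have := (((hasFDerivAt_id w).sub_const z).norm_sq).const_mul c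
  rw [hasGradientAt_iff_hasFDerivAt]
  refine this.congr_fderiv ?_
  ext v
  simp
  ring

/-- Closed graphs of the normal cones and continuity of F' let the stationarity relation pass to the
limit. -/
theorem normals_of_tendsto {D : Set E} {K : Set W} {F' : E → E →L[ℝ] W} (hF' : Continuous F')
    {zs ws : ℕ → E} {ys ps : ℕ → W} {z w : E} {y p : W}
    (hz : Tendsto zs atTop (𝓝 z)) (hw : Tendsto ws atTop (𝓝 w))
    (hy : Tendsto ys atTop (𝓝 y)) (hp : Tendsto ps atTop (𝓝 p))
    (hK : ∀ k, ps k ∈ limitingNormalCone K (ys k))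
    (hDn : ∀ k, ws k - adjoint (F' (zs k)) (ps k) ∈ limitingNormalCone D (zs k)) :
    p ∈ limitingNormalCone K y ∧ w - adjoint (F' z) p ∈ limitingNormalCone D z := by
  refine ⟨mem_limitingNormalCone_of_tendsto hy hp hK,
    mem_limitingNormalCone_of_tendsto hz (hw.sub ?_) hDn⟩
  have h1 : Tendsto (fun k => adjoint (F' (zs k))) atTop (𝓝 (adjoint (F' z))) :=
    (adjoint.continuous.comp hF').continuousAt.tendsto.comp hz
  exact (isBoundedBilinearMap_apply (𝕜 := ℝ) (E := W) (F := E)).continuous.tendsto _ |>.comp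
    (h1.prodMk_nhds hp)

/-- Perturbing a point that violates an error bound to a point with small normal vectors. -/
theorem exists_normals_of_lt_infDist {D : Set E} (hD : IsClosed D) {K : Set W} (hK : IsClosed K)
    {F : E → W} {F' : E → E →L[ℝ] W} (hF : ∀ z, HasStrictFDerivAt F (F' z) z) (hK₀ : K.Nonempty)
    {z : E} (hz : z ∈ D) {c : ℝ} (hc : 0 < c)
    (hlt : c * Metric.infDist (F z) K < Metric.infDist z (D ∩ F ⁻¹' K)) :
    ∃ w ∈ D, ∃ y ∈ K, ∃ p e, dist w z ≤ Metric.infDist z (D ∩ F ⁻¹' K) ∧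
      Metric.infDist (F w) K = dist (F w) y ∧ ‖p‖ = 1 ∧ p ∈ proximalNormalCone K y ∧
      e - adjoint (F' w) p ∈ limitingNormalCone D w ∧ ‖e‖ ≤ 4 / c := by
  set r := Metric.infDist z (D ∩ F ⁻¹' K) with hr
  have hr0 : 0 < r := lt_of_le_of_lt (mul_nonneg hc.le Metric.infDist_nonneg) hlt
  have hFc : Continuous F := continuous_iff_continuousAt.2 fun z => (hF z).continuousAt
  -- Comparing the minimizer w with z gives 4‖w - z‖²/r < r, so ‖w - z‖ < r/2. Thus w is infeasible
  -- and interior to the ball, and the gradient 2a(w - z) has norm at most 4/c.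
  set a : ℝ := 4 / (c * r) with ha
  have ha0 : 0 < a := by positivity
  have hcompact : IsCompact (D ∩ Metric.closedBall z r) :=
    (isCompact_closedBall z r).inter_left hD
  obtain ⟨w, hw, hmin⟩ := hcompact.exists_isMinOn ⟨z, hz, Metric.mem_closedBall_self hr0.le⟩
    (f := fun x => Metric.infDist (F x) K + a * ‖x - z‖ ^ 2) (by
      have := (Metric.continuous_infDist_pt K).comp hFc
      exact (this.add (by fun_prop)).continuousOn)
  have hwz : ‖w - z‖ < r / 2 := by
    have h1 : Metric.infDist (F w) K + a * ‖w - z‖ ^ 2 ≤ Metric.infDist (F z) K + a * ‖z - z‖ ^ 2 :=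
      hmin ⟨hz, Metric.mem_closedBall_self hr0.le⟩
    have h2 : a * ‖w - z‖ ^ 2 ≤ Metric.infDist (F z) K := by
      have := @Metric.infDist_nonneg _ _ K (F w)
      simp at h1; linarith
    have h3 : c * (a * ‖w - z‖ ^ 2) < r := lt_of_le_of_lt (mul_le_mul_of_nonneg_left h2 hc.le) hlt
    have h4 : c * (a * ‖w - z‖ ^ 2) = 4 * ‖w - z‖ ^ 2 / r := by rw [ha]; field_simp
    rw [h4, div_lt_iff₀ hr0] at h3
    nlinarith [norm_nonneg (w - z)]
  obtain ⟨y, hy, hyd⟩ := hK.exists_infDist_eq_dist hK₀ (F w)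
  have hFw : F w ∉ K := fun h => by
    have := Metric.infDist_le_dist_of_mem (x := z) (show w ∈ D ∩ F ⁻¹' K from ⟨hw.1, h⟩)
    rw [dist_comm, dist_eq_norm] at this
    linarith
  set s := ‖F w - y‖ with hs
  have hs0 : 0 < s := norm_pos_iff.2 (sub_ne_zero.2 fun h => hFw (h ▸ hy))
  have hyd' : Metric.infDist (F w) K = s := by rw [hyd, dist_eq_norm]
  refine ⟨w, hw.1, y, hy, s⁻¹ • (F w - y), -((2 * a) • (w - z)), ?_, hyd, ?_, ?_, ?_, ?_⟩
  · rw [dist_eq_norm]; linarith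
  · rw [norm_smul, Real.norm_of_nonneg (by positivity), inv_mul_cancel₀ hs0.ne']
  · exact smul_mem_proximalNormalCone (sub_mem_proximalNormalCone_of_infDist_eq hy hyd)
      (by positivity)
  · refine penalized_normal hD (hF w).hasFDerivAt hw.1 y s⁻¹ (hasGradientAt_norm_sub_sq a z w) ?_
    have hnear : ∀ᶠ x in 𝓝[D] w, x ∈ Metric.closedBall z r := by
      refine mem_nhdsWithin_of_mem_nhds (Metric.isOpen_ball.mem_nhds ?_ |> mem_of_superset <|
        Metric.ball_subset_closedBall)
      rw [Metric.mem_ball, dist_eq_norm]; linarith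
    filter_upwards [hnear, self_mem_nhdsWithin] with x hx hxD
    have h1 : Metric.infDist (F w) K + a * ‖w - z‖ ^ 2 ≤ Metric.infDist (F x) K + a * ‖x - z‖ ^ 2 :=
      hmin ⟨hxD, hx⟩
    have h2 : Metric.infDist (F x) K ≤ ‖F x - y‖ := by
      rw [← dist_eq_norm]; exact Metric.infDist_le_dist_of_mem hy
    -- This quadratic majorant of the distance is exact at w, where ‖F w - y‖ = s, so w also
    -- minimizes the smooth penalized function.
    have h3 : ‖F x - y‖ ≤ s⁻¹ / 2 * ‖F x - y‖ ^ 2 + s / 2 := by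
      have : s⁻¹ / 2 * ‖F x - y‖ ^ 2 + s / 2 - ‖F x - y‖ = s⁻¹ / 2 * (‖F x - y‖ - s) ^ 2 := by
        field_simp; ring
      have : 0 ≤ s⁻¹ / 2 * (‖F x - y‖ - s) ^ 2 := by positivity
      linarith
    have h4 : s⁻¹ / 2 * s ^ 2 = s / 2 := by field_simp
    simp only [← hs, h4]
    linarith
  · rw [norm_neg, norm_smul, Real.norm_of_nonneg (by positivity)]
    have : 4 / c = 2 * a * (r / 2) := by rw [ha]; field_simp
    rw [this]
    exact mul_le_mul_of_nonneg_left hwz.le (by positivity)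

/-- The error bound for `z ∈ D`, `F z ∈ K` under the normal cone qualification condition. -/
theorem exists_errorBound {D : Set E} (hD : IsClosed D) {K : Set W} (hK : IsClosed K)
    {F : E → W} {F' : E → E →L[ℝ] W} (hF : ∀ z, HasStrictFDerivAt F (F' z) z)
    {z : E} (hFz : F z ∈ K)
    (hCQ : ∀ p ∈ limitingNormalCone K (F z),
      -adjoint (F' z) p ∈ limitingNormalCone D z → p = 0) :
    ∃ τ : ℝ, 0 < τ ∧ ∃ δ : ℝ, 0 < δ ∧ ∀ x ∈ Metric.ball z δ ∩ D,
      Metric.infDist x (D ∩ F ⁻¹' K) ≤ τ * Metric.infDist (F x) K := by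
  by_contra! hcon
  by_cases hzD : z ∉ D
  · obtain ⟨δ, hδ, hball⟩ := Metric.isOpen_iff.1 hD.isOpen_compl z hzD
    obtain ⟨x, hx, -⟩ := hcon 1 one_pos δ hδ
    exact hball hx.1 hx.2
  rw [not_not] at hzD
  have hpos : ∀ k : ℕ, (0 : ℝ) < k + 1 := fun k => by positivity
  have hstep : ∀ k : ℕ, ∃ w ∈ D, ∃ y ∈ K, ∃ p e, dist w z ≤ 2 * (1 / ((k : ℝ) + 1)) ∧
      Metric.infDist (F w) K = dist (F w) y ∧ ‖p‖ = 1 ∧ p ∈ proximalNormalCone K y ∧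
      e - adjoint (F' w) p ∈ limitingNormalCone D w ∧ ‖e‖ ≤ 4 * (1 / ((k : ℝ) + 1)) := by
    intro k
    obtain ⟨x, ⟨hx, hxD⟩, hlt⟩ := hcon _ (hpos k) _ (Nat.one_div_pos_of_nat (n := k))
    obtain ⟨w, hw, y, hy, p, e, h1, h2, h3, h4, h5, h6⟩ :=
      exists_normals_of_lt_infDist hD hK hF ⟨_, hFz⟩ hxD (hpos k) hlt
    refine ⟨w, hw, y, hy, p, e, ?_, h2, h3, h4, h5, by rwa [mul_one_div]⟩
    have h7 := Metric.infDist_le_dist_of_mem (x := x) (show z ∈ D ∩ F ⁻¹' K from ⟨hzD, hFz⟩)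
    rw [Metric.mem_ball] at hx
    linarith [dist_triangle w x z]
  choose w hwD y hyK p e hwz hyd hp1 hpK hDn he using hstep
  have h0 := tendsto_one_div_add_atTop_nhds_zero_nat (𝕜 := ℝ)
  have hwt : Tendsto w atTop (𝓝 z) := tendsto_iff_dist_tendsto_zero.2
    (squeeze_zero (fun _ => dist_nonneg) hwz (by simpa using h0.const_mul 2))
  have het : Tendsto e atTop (𝓝 0) := tendsto_zero_iff_norm_tendsto_zero.2
    (squeeze_zero (fun _ => norm_nonneg _) he (by simpa using h0.const_mul 4))
  have hFwt : Tendsto (fun k => F (w k)) atTop (𝓝 (F z)) := (hF z).continuousAt.tendsto.comp hwt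
  have hyt : Tendsto y atTop (𝓝 (F z)) := by
    have h1 : Tendsto (fun k => dist (F (w k)) (y k)) atTop (𝓝 0) :=
      squeeze_zero (fun _ => dist_nonneg)
        (fun k => (hyd k).symm.le.trans (Metric.infDist_le_dist_of_mem hFz))
        (tendsto_iff_dist_tendsto_zero.1 hFwt)
    exact hFwt.congr_dist h1
  -- The unit normals cluster at a unit vector q; since e → 0, q is a multiplier for 0.
  obtain ⟨q, -, s, hs, hq⟩ := tendsto_subseq_of_bounded (Metric.isBounded_sphere (x := (0 : W))
    (r := 1)) (x := p) (fun k => by simp [hp1])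
  obtain ⟨h1, h2⟩ := normals_of_tendsto (continuous_of_hasStrictFDerivAt hF)
    (hwt.comp hs.tendsto_atTop) (het.comp hs.tendsto_atTop) (hyt.comp hs.tendsto_atTop) hq
    (fun k => proximalNormalCone_subset_limitingNormalCone _ _ (hpK (s k))) (fun k => hDn (s k))
  have hq0 := hCQ q h1 (by simpa using h2)
  have hq1 : Tendsto (fun k => ‖p (s k)‖) atTop (𝓝 ‖q‖) := hq.norm
  simp [hp1, hq0] at hq1

/-- Proximal normals to `{z ∈ D | F z ∈ K}` under the normal cone qualification condition. -/
theorem exists_multiplier_of_mem_proximalNormalCone {D : Set E} (hD : IsClosed D) {K : Set W}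
    (hK : IsClosed K) {F : E → W} {F' : E → E →L[ℝ] W} (hF : ∀ z, HasStrictFDerivAt F (F' z) z)
    {z : E} (hzD : z ∈ D) (hFz : F z ∈ K)
    (hCQ : ∀ p ∈ limitingNormalCone K (F z),
      -adjoint (F' z) p ∈ limitingNormalCone D z → p = 0)
    {v : E} (hv : v ∈ proximalNormalCone (D ∩ F ⁻¹' K) z) :
    ∃ p ∈ limitingNormalCone K (F z), v - adjoint (F' z) p ∈ limitingNormalCone D z := by
  obtain ⟨-, σ, hσ, hv⟩ := hv
  have hFc : Continuous F := continuous_iff_continuousAt.2 fun z => (hF z).continuousAt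
  have hcompact : IsCompact (D ∩ Metric.closedBall z 1) :=
    (isCompact_closedBall z 1).inter_left hD
  have hzB : z ∈ D ∩ Metric.closedBall z 1 := ⟨hzD, Metric.mem_closedBall_self zero_le_one⟩
  -- The proximal inequality makes z a minimizer over the feasible set with coefficient σ; the extra
  -- 1 makes it the unique one, so penalized minimizers must converge to it.
  set ψ : E → ℝ := fun x => (σ + 1) * ‖x - z‖ ^ 2 - ⟪v, x⟫ with hψ
  have hψg : ∀ w, HasGradientAt ψ ((2 * (σ + 1)) • (w - z) - v) w := by
    intro w
    have := (hasGradientAt_norm_sub_sq (σ + 1) z w).hasFDerivAt.sub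
      (InnerProductSpace.toDual ℝ E v).hasFDerivAt
    rw [hasGradientAt_iff_hasFDerivAt, map_sub]
    exact this
  have hmin : ∀ k : ℕ, ∃ w ∈ D ∩ Metric.closedBall z 1, IsMinOn
      (fun x => ψ x + (k : ℝ) / 2 * Metric.infDist (F x) K ^ 2) (D ∩ Metric.closedBall z 1) w := by
    intro k
    refine hcompact.exists_isMinOn ⟨z, hzB⟩ ?_
    have := (Metric.continuous_infDist_pt K).comp hFc
    exact ((by fun_prop : Continuous ψ).add (continuous_const.mul (this.pow 2))).continuousOn
  choose w hwB hwmin using hmin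
  have hval : ∀ k : ℕ, (σ + 1) * ‖w k - z‖ ^ 2 + (k : ℝ) / 2 * Metric.infDist (F (w k)) K ^ 2 ≤
      ⟪v, w k - z⟫ := by
    intro k
    have h1 : ψ (w k) + (k : ℝ) / 2 * Metric.infDist (F (w k)) K ^ 2 ≤
      ψ z + (k : ℝ) / 2 * Metric.infDist (F z) K ^ 2 := hwmin k hzB
    rw [Metric.infDist_zero_of_mem hFz] at h1
    simp only [hψ, sub_self, norm_zero] at h1
    rw [inner_sub_right]
    linarith
  obtain ⟨x, hx, s, hs, hwx⟩ := hcompact.tendsto_subseq hwB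
  have hxz : x = z := by
    have hFx : F x ∈ K := by
      have h1 : Tendsto (fun k => Metric.infDist (F (w (s k))) K ^ 2) atTop
          (𝓝 (Metric.infDist (F x) K ^ 2)) :=
        ((((Metric.continuous_infDist_pt K).comp hFc).pow 2).continuousAt.tendsto).comp hwx
      have h2 : Tendsto (fun k => Metric.infDist (F (w (s k))) K ^ 2) atTop (𝓝 0) := by
        -- The shift makes the penalty weight s (k + 1) at least k + 1, hence positive.
        refine (tendsto_add_atTop_iff_nat 1).1 ?_
        refine squeeze_zero (g := fun k : ℕ => 2 * ‖v‖ * (1 / ((k : ℝ) + 1)))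
          (fun _ => by positivity) (fun k => ?_)
          (by simpa using (tendsto_one_div_add_atTop_nhds_zero_nat (𝕜 := ℝ)).const_mul (2 * ‖v‖))
        have h3 := hval (s (k + 1))
        have h4 : ‖w (s (k + 1)) - z‖ ≤ 1 := by
          rw [← dist_eq_norm]; exact (hwB _).2
        have h5 : ⟪v, w (s (k + 1)) - z⟫ ≤ ‖v‖ := (real_inner_le_norm _ _).trans
          (mul_le_of_le_one_right (norm_nonneg _) h4)
        have h6 : (k : ℝ) + 1 ≤ (s (k + 1) : ℝ) := by exact_mod_cast hs.le_apply (x := k + 1)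
        have h7 : 0 ≤ (σ + 1) * ‖w (s (k + 1)) - z‖ ^ 2 := by positivity
        rw [mul_one_div, le_div_iff₀ (by positivity)]
        nlinarith [sq_nonneg (Metric.infDist (F (w (s (k + 1)))) K)]
      have h3 := pow_eq_zero_iff (two_ne_zero) |>.1 (tendsto_nhds_unique h1 h2)
      exact (hK.mem_iff_infDist_zero ⟨_, hFz⟩).2 h3
    have h1 : (σ + 1) * ‖x - z‖ ^ 2 ≤ ⟪v, x - z⟫ := by
      refine le_of_tendsto_of_tendsto' (((by fun_prop : Continuous
        fun x : E => (σ + 1) * ‖x - z‖ ^ 2).tendsto x).comp hwx) (((by fun_prop : Continuous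
        fun x : E => ⟪v, x - z⟫).tendsto x).comp hwx) fun k => ?_
      have h2 : 0 ≤ (s k : ℝ) / 2 * Metric.infDist (F (w (s k))) K ^ 2 := by positivity
      have := hval (s k)
      simp only [Function.comp_apply]
      linarith
    have h2 := hv x ⟨hx.1, hFx⟩
    have h3 : ‖x - z‖ ^ 2 ≤ 0 := by linarith
    exact sub_eq_zero.1 (norm_eq_zero.1 (pow_eq_zero_iff two_ne_zero |>.1
      (le_antisymm h3 (by positivity))))
  rw [hxz] at hwx
  choose y hyK hyd using fun k => hK.exists_infDist_eq_dist ⟨_, hFz⟩ (F (w (s k)))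
  have hFwt : Tendsto (fun k => F (w (s k))) atTop (𝓝 (F z)) :=
    (hF z).continuousAt.tendsto.comp hwx
  have hyt : Tendsto y atTop (𝓝 (F z)) := by
    have h1 : Tendsto (fun k => dist (F (w (s k))) (y k)) atTop (𝓝 0) :=
      squeeze_zero (fun _ => dist_nonneg)
        (fun k => (hyd k).symm.le.trans (Metric.infDist_le_dist_of_mem hFz))
        (tendsto_iff_dist_tendsto_zero.1 hFwt)
    exact hFwt.congr_dist h1
  -- The multiplier is the gradient of the quadratic penalty, with the nearest point y k held fixed.
  set p : ℕ → W := fun k => (s k : ℝ) • (F (w (s k)) - y k) with hp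
  set e : ℕ → E := fun k => -((2 * (σ + 1)) • (w (s k) - z) - v) with he
  have het : Tendsto e atTop (𝓝 v) := by
    have h1 : Tendsto (fun x : E => -((2 * (σ + 1)) • (x - z) - v)) (𝓝 z) (𝓝 v) :=
      (by fun_prop : Continuous fun x : E => -((2 * (σ + 1)) • (x - z) - v)).tendsto' z v (by simp)
    exact h1.comp hwx
  have hpK : ∀ k, p k ∈ limitingNormalCone K (y k) := fun k =>
    proximalNormalCone_subset_limitingNormalCone _ _ <| smul_mem_proximalNormalCone
      (sub_mem_proximalNormalCone_of_infDist_eq (hyK k) (hyd k)) (by positivity)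
  have hnear : ∀ᶠ k in atTop, w (s k) ∈ Metric.ball z 1 :=
    hwx (Metric.ball_mem_nhds z one_pos)
  obtain ⟨N, hN⟩ := eventually_atTop.1 hnear
  have hDn : ∀ k, N ≤ k →
      e k - adjoint (F' (w (s k))) (p k) ∈ limitingNormalCone D (w (s k)) := by
    intro k hk
    refine penalized_normal hD (hF _).hasFDerivAt (hwB _).1 (y k) (s k) (hψg _) ?_
    filter_upwards [mem_nhdsWithin_of_mem_nhds (Metric.isOpen_ball.mem_nhds (hN k hk)),
      self_mem_nhdsWithin] with u hu huD
    have h1 : ψ (w (s k)) + (s k : ℝ) / 2 * Metric.infDist (F (w (s k))) K ^ 2 ≤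
        ψ u + (s k : ℝ) / 2 * Metric.infDist (F u) K ^ 2 :=
      hwmin (s k) ⟨huD, Metric.ball_subset_closedBall hu⟩
    rw [hyd k, dist_eq_norm] at h1
    have h2 : Metric.infDist (F u) K ≤ ‖F u - y k‖ := by
      rw [← dist_eq_norm]; exact Metric.infDist_le_dist_of_mem (hyK k)
    have h3 := pow_le_pow_left₀ Metric.infDist_nonneg h2 2
    have h4 := mul_le_mul_of_nonneg_left h3 (by positivity : 0 ≤ (s k : ℝ) / 2)
    linarith
  have hF'c := continuous_of_hasStrictFDerivAt hF
  have hsub : ∀ φ : ℕ → ℕ, StrictMono φ → StrictMono fun k => φ (k + N) :=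
    fun φ hφ a b hab => hφ (by omega)
  -- A bounded subsequence of p yields a multiplier for v. Otherwise ‖p‖ → ∞, and normalizing kills
  -- e, leaving a unit multiplier for 0.
  by_cases hbdd : ∃ C : ℝ, ∃ᶠ k in atTop, p k ∈ Metric.closedBall 0 C
  · obtain ⟨C, hC⟩ := hbdd
    obtain ⟨q, -, φ, hφ, hq⟩ := tendsto_subseq_of_frequently_bounded Metric.isBounded_closedBall hC
    have hφ' := hsub φ hφ
    have hq' : Tendsto (fun k => p (φ (k + N))) atTop (𝓝 q) :=
      hq.comp (tendsto_add_atTop_nat N)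
    exact ⟨q, normals_of_tendsto hF'c (hwx.comp hφ'.tendsto_atTop) (het.comp hφ'.tendsto_atTop)
      (hyt.comp hφ'.tendsto_atTop) hq' (fun k => hpK _)
      (fun k => hDn _ ((Nat.le_add_left N k).trans hφ.le_apply))⟩
  · exfalso
    have hinf : Tendsto (fun k => ‖p k‖) atTop atTop := by
      refine tendsto_atTop.2 fun C => ?_
      have h1 : ∀ᶠ k in atTop, p k ∉ Metric.closedBall 0 C := by
        by_contra h; exact hbdd ⟨C, fun h' => h h'⟩
      filter_upwards [h1] with k hk
      simp only [mem_closedBall_zero_iff, not_le] at hk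
      exact hk.le
    obtain ⟨M, hM⟩ := eventually_atTop.1 (hinf.eventually_gt_atTop 0)
    obtain ⟨q, -, φ, hφ, hq⟩ := tendsto_subseq_of_bounded (Metric.isBounded_sphere
      (x := (0 : W)) (r := 1)) (x := fun k => ‖p (k + (N + M))‖⁻¹ • p (k + (N + M))) (fun k => by
        have := hM (k + (N + M)) (by omega)
        simp [norm_smul, this.ne'])
    have hφ' : Tendsto (fun k => φ k + (N + M)) atTop atTop :=
      (tendsto_add_atTop_nat (N + M)).comp hφ.tendsto_atTop
    have het' : Tendsto (fun k => ‖p (φ k + (N + M))‖⁻¹ • e (φ k + (N + M))) atTop (𝓝 0) := by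
      have := (hinf.inv_tendsto_atTop.smul het).comp hφ'
      rwa [zero_smul] at this
    obtain ⟨h1, h2⟩ := normals_of_tendsto hF'c (hwx.comp hφ') het' (hyt.comp hφ') hq
      (fun k => smul_mem_limitingNormalCone (hpK _) (by positivity))
      (fun k => by
        have := smul_mem_limitingNormalCone (hDn (φ k + (N + M)) (by omega))
          (c := ‖p (φ k + (N + M))‖⁻¹) (by positivity)
        rw [smul_sub, ← map_smul] at this
        exact this)
    have hq0 := hCQ q h1 (by simpa using h2)
    have hq1 : Tendsto (fun k => ‖‖p (φ k + (N + M))‖⁻¹ • p (φ k + (N + M))‖) atTop (𝓝 ‖q‖) :=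
      hq.norm
    have hq2 : ∀ k, ‖‖p (φ k + (N + M))‖⁻¹ • p (φ k + (N + M))‖ = 1 := fun k => by
      have := hM (φ k + (N + M)) (by omega)
      simp [norm_smul, this.ne']
    simp [hq2, hq0] at hq1

end ConstraintSystems

/-! ### Normals to the constraint cone and to ℝⁿ × U. -/

section ConeNormals

/-- Insert y + s • e in the proximal inequality, divide by s and let s → 0⁺: the quadratic term
vanishes. -/
theorem inner_nonpos_of_feasible_direction {E : Type*} [NormedAddCommGroup E]
    [InnerProductSpace ℝ E] {Ω : Set E} {y p e : E} (hp : p ∈ proximalNormalCone Ω y) {δ : ℝ}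
    (hδ : 0 < δ) (h : ∀ s, 0 < s → s < δ → y + s • e ∈ Ω) : ⟪p, e⟫ ≤ 0 := by
  obtain ⟨-, σ, -, hp⟩ := hp
  have hlim : Tendsto (fun s : ℝ => σ * (s * ‖e‖ ^ 2)) (𝓝[>] 0) (𝓝 0) :=
    ((by fun_prop : Continuous fun s : ℝ => σ * (s * ‖e‖ ^ 2)).tendsto' 0 0 (by simp)).mono_left
      nhdsWithin_le_nhds
  refine ge_of_tendsto hlim ?_
  filter_upwards [Ioo_mem_nhdsGT hδ] with s hs
  have h1 := hp _ (h s hs.1 hs.2)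
  rw [add_sub_cancel_left, real_inner_smul_right, norm_smul, Real.norm_of_nonneg hs.1.le] at h1
  refine le_of_mul_le_mul_left (h1.trans (le_of_eq ?_)) hs.1
  ring

theorem norm_le_norm_fst_add_norm_snd {E F : Type*} [SeminormedAddCommGroup E]
    [SeminormedAddCommGroup F] (x : WithLp 2 (E × F)) : ‖x‖ ≤ ‖x.fst‖ + ‖x.snd‖ := by
  refine le_of_sq_le_sq ?_ (by positivity)
  rw [WithLp.prod_norm_sq_eq_of_L2]
  nlinarith [norm_nonneg x.fst, norm_nonneg x.snd]

theorem mem_complementarityCone_iff {l : ℕ} {c : EuclProd l l} :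
    c ∈ complementarityCone l ↔ ∀ i, 0 ≤ c.fst i ∧ 0 ≤ c.snd i ∧ c.fst i * c.snd i = 0 := by
  constructor
  · rintro ⟨h1, h2, h3⟩ i
    refine ⟨h1 i, h2 i, ?_⟩
    simp only [PiLp.inner_apply, RCLike.inner_apply, conj_trivial] at h3
    rw [mul_comm]
    exact (Finset.sum_eq_zero_iff_of_nonneg fun j _ => mul_nonneg (h2 j) (h1 j)).1 h3 i
      (Finset.mem_univ i)
  · intro h
    refine ⟨fun i => (h i).1, fun i => (h i).2.1, ?_⟩
    simp only [PiLp.inner_apply, RCLike.inner_apply, conj_trivial]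
    exact Finset.sum_eq_zero fun i _ => by rw [mul_comm]; exact (h i).2.2

theorem isClosed_complementarityCone (l : ℕ) : IsClosed (complementarityCone l) := by
  have h : complementarityCone l =
      ⋂ i, {c | 0 ≤ c.fst i ∧ 0 ≤ c.snd i ∧ c.fst i * c.snd i = 0} := by
    ext c; simp [mem_complementarityCone_iff]
  rw [h]
  refine isClosed_iInter fun i => ?_
  have h1 : Continuous fun c : EuclProd l l => c.fst i :=
    (EuclideanSpace.proj i).continuous.comp (WithLp.continuous_fst _ _ _)
  have h2 : Continuous fun c : EuclProd l l => c.snd i :=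
    (EuclideanSpace.proj i).continuous.comp (WithLp.continuous_snd _ _ _)
  exact (isClosed_le continuous_const h1).inter ((isClosed_le continuous_const h2).inter
    (isClosed_eq (h1.mul h2) continuous_const))

/-- The space of values of the four constraint maps, with its Euclidean norm. -/
abbrev ConstraintSpace (l₁ l₂ l : ℕ) : Type := WithLp 2 (EuclProd l₁ l₂ × EuclProd l l)

/-- The cone `{(a, b, c) : a ≤ 0, b = 0, c ∈ complementarityCone l}`. -/
def constraintCone (l₁ l₂ l : ℕ) : Set (ConstraintSpace l₁ l₂ l) :=
  {y | (∀ i, y.fst.fst i ≤ 0) ∧ y.fst.snd = 0 ∧ y.snd ∈ complementarityCone l}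

variable {l₁ l₂ l : ℕ}

theorem continuous_fst_fst (i : Fin l₁) :
    Continuous fun y : ConstraintSpace l₁ l₂ l => y.fst.fst i :=
  (EuclideanSpace.proj i).continuous.comp
    ((WithLp.continuous_fst _ _ _).comp (WithLp.continuous_fst _ _ _))

theorem continuous_snd_fst (i : Fin l) :
    Continuous fun y : ConstraintSpace l₁ l₂ l => y.snd.fst i :=
  (EuclideanSpace.proj i).continuous.comp
    ((WithLp.continuous_fst _ _ _).comp (WithLp.continuous_snd _ _ _))

theorem continuous_snd_snd (i : Fin l) :
    Continuous fun y : ConstraintSpace l₁ l₂ l => y.snd.snd i :=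
  (EuclideanSpace.proj i).continuous.comp
    ((WithLp.continuous_snd _ _ _).comp (WithLp.continuous_snd _ _ _))

theorem isClosed_constraintCone : IsClosed (constraintCone l₁ l₂ l) := by
  refine IsClosed.inter ?_ (IsClosed.inter ?_ ?_)
  · have h : {y : ConstraintSpace l₁ l₂ l | ∀ i, y.fst.fst i ≤ 0} = ⋂ i, {y | y.fst.fst i ≤ 0} := by
      ext; simp
    change IsClosed {y : ConstraintSpace l₁ l₂ l | ∀ i, y.fst.fst i ≤ 0}
    rw [h]
    exact isClosed_iInter fun i => isClosed_le (continuous_fst_fst i) continuous_const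
  · exact isClosed_eq ((WithLp.continuous_snd _ _ _).comp (WithLp.continuous_fst _ _ _))
      continuous_const
  · exact (isClosed_complementarityCone l).preimage (WithLp.continuous_snd _ _ _)

/-- The sign and complementarity conditions satisfied by limiting normals to the constraint
cone. -/
structure IsConeNormal (y p : ConstraintSpace l₁ l₂ l) : Prop where
  nonneg : ∀ i, 0 ≤ p.fst.fst i
  inactive : ∀ i, y.fst.fst i < 0 → p.fst.fst i = 0
  fst_eq_zero : ∀ i, 0 < y.snd.fst i → p.snd.fst i = 0
  snd_eq_zero : ∀ i, 0 < y.snd.snd i → p.snd.snd i = 0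
  degenerate : ∀ i, (p.snd.fst i ≤ 0 ∧ p.snd.snd i ≤ 0) ∨ p.snd.fst i * p.snd.snd i = 0

/-- Each condition comes from moving one coordinate while staying in the cone. A positive coordinate
can move both ways, which forces its multiplier to vanish. -/
theorem isConeNormal_of_mem_proximalNormalCone {y p : ConstraintSpace l₁ l₂ l}
    (hp : p ∈ proximalNormalCone (constraintCone l₁ l₂ l) y) : IsConeNormal y p := by
  have hy : y ∈ constraintCone l₁ l₂ l := isClosed_constraintCone.closure_eq ▸ hp.1
  obtain ⟨hy1, hy2, hy3⟩ := hy
  have hg : ∀ (i : Fin l₁) (r δ : ℝ), 0 < δ → (∀ s, 0 < s → s < δ → y.fst.fst i + s * r ≤ 0) →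
      r * p.fst.fst i ≤ 0 := by
    intro i r δ hδ h
    have := inner_nonpos_of_feasible_direction (e := WithLp.toLp 2
      (WithLp.toLp 2 (EuclideanSpace.single i r, 0), 0)) hp hδ (fun s hs hsδ => by
        refine ⟨fun j => ?_, by simpa using hy2, by simpa using hy3⟩
        by_cases hj : j = i
        · subst hj; simpa using h s hs hsδ
        · simpa [hj] using hy1 j)
    simpa [WithLp.prod_inner_apply, EuclideanSpace.inner_single_right] using this
  have hGG : ∀ (i : Fin l) (r δ : ℝ), 0 < δ → y.snd.snd i = 0 →
      (∀ s, 0 < s → s < δ → 0 ≤ y.snd.fst i + s * r) → r * p.snd.fst i ≤ 0 := by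
    intro i r δ hδ h0 h
    rw [mem_complementarityCone_iff] at hy3
    have := inner_nonpos_of_feasible_direction (e := WithLp.toLp 2
      (0, WithLp.toLp 2 (EuclideanSpace.single i r, 0))) hp hδ (fun s hs hsδ => by
        refine ⟨by simpa using hy1, by simpa using hy2,
          mem_complementarityCone_iff.2 fun j => ?_⟩
        by_cases hj : j = i
        · subst hj; simpa [h0] using h s hs hsδ
        · simpa [hj] using hy3 j)
    simpa [WithLp.prod_inner_apply, EuclideanSpace.inner_single_right] using this
  have hHH : ∀ (i : Fin l) (r δ : ℝ), 0 < δ → y.snd.fst i = 0 →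
      (∀ s, 0 < s → s < δ → 0 ≤ y.snd.snd i + s * r) → r * p.snd.snd i ≤ 0 := by
    intro i r δ hδ h0 h
    rw [mem_complementarityCone_iff] at hy3
    have := inner_nonpos_of_feasible_direction (e := WithLp.toLp 2
      (0, WithLp.toLp 2 (0, EuclideanSpace.single i r))) hp hδ (fun s hs hsδ => by
        refine ⟨by simpa using hy1, by simpa using hy2,
          mem_complementarityCone_iff.2 fun j => ?_⟩
        by_cases hj : j = i
        · subst hj; simpa [h0] using h s hs hsδ
        · simpa [hj] using hy3 j)
    simpa [WithLp.prod_inner_apply, EuclideanSpace.inner_single_right] using this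
  rw [mem_complementarityCone_iff] at hy3
  have hnonneg : ∀ i, 0 ≤ p.fst.fst i := fun i => by
    have := hg i (-1) 1 one_pos (fun s hs _ => by have := hy1 i; linarith)
    linarith
  have hfst : ∀ i, 0 < y.snd.fst i → p.snd.fst i = 0 := fun i hi => by
    have h0 : y.snd.snd i = 0 := by
      rcases mul_eq_zero.1 (hy3 i).2.2 with h | h
      · exact absurd h hi.ne'
      · exact h
    have h1 := hGG i 1 1 one_pos h0 (fun s hs _ => by linarith)
    have h2 := hGG i (-1) _ hi h0 (fun s hs _ => by linarith)
    linarith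
  have hsnd : ∀ i, 0 < y.snd.snd i → p.snd.snd i = 0 := fun i hi => by
    have h0 : y.snd.fst i = 0 := by
      rcases mul_eq_zero.1 (hy3 i).2.2 with h | h
      · exact h
      · exact absurd h hi.ne'
    have h1 := hHH i 1 1 one_pos h0 (fun s hs _ => by linarith)
    have h2 := hHH i (-1) _ hi h0 (fun s hs _ => by linarith)
    linarith
  refine ⟨hnonneg, fun i hi => ?_, hfst, hsnd, fun i => ?_⟩
  · have := hg i 1 (-y.fst.fst i) (by linarith) (fun s hs _ => by linarith)
    linarith [hnonneg i]
  · rcases (hy3 i).1.eq_or_lt with h1 | h1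
    · rcases (hy3 i).2.1.eq_or_lt with h2 | h2
      · have h3 := hGG i 1 1 one_pos h2.symm (fun s hs _ => by linarith)
        have h4 := hHH i 1 1 one_pos h1.symm (fun s hs _ => by linarith)
        left
        constructor <;> linarith
      · right; rw [hsnd i h2, mul_zero]
    · right; rw [hfst i h1, zero_mul]

theorem isConeNormal_of_mem_limitingNormalCone {y p : ConstraintSpace l₁ l₂ l}
    (hp : p ∈ limitingNormalCone (constraintCone l₁ l₂ l) y) : IsConeNormal y p := by
  obtain ⟨ys, ps, hys, hps, h⟩ := hp
  replace h := fun k => isConeNormal_of_mem_proximalNormalCone (h k)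
  have hgp := fun i => ((continuous_fst_fst (l₂ := l₂) (l := l) i).tendsto p).comp hps
  have hGp := fun i => ((continuous_snd_fst (l₁ := l₁) (l₂ := l₂) i).tendsto p).comp hps
  have hHp := fun i => ((continuous_snd_snd (l₁ := l₁) (l₂ := l₂) i).tendsto p).comp hps
  have hgy := fun i => ((continuous_fst_fst (l₂ := l₂) (l := l) i).tendsto y).comp hys
  have hGy := fun i => ((continuous_snd_fst (l₁ := l₁) (l₂ := l₂) i).tendsto y).comp hys
  have hHy := fun i => ((continuous_snd_snd (l₁ := l₁) (l₂ := l₂) i).tendsto y).comp hys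
  refine ⟨fun i => ?_, fun i hi => ?_, fun i hi => ?_, fun i hi => ?_, fun i => ?_⟩
  · exact ge_of_tendsto' (hgp i) fun k => (h k).nonneg i
  · refine tendsto_nhds_unique_of_eventuallyEq (hgp i) tendsto_const_nhds ?_
    filter_upwards [(hgy i).eventually_lt_const hi] with k hk using (h k).inactive i hk
  · refine tendsto_nhds_unique_of_eventuallyEq (hGp i) tendsto_const_nhds ?_
    filter_upwards [(hGy i).eventually_const_lt hi] with k hk using (h k).fst_eq_zero i hk
  · refine tendsto_nhds_unique_of_eventuallyEq (hHp i) tendsto_const_nhds ?_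
    filter_upwards [(hHy i).eventually_const_lt hi] with k hk using (h k).snd_eq_zero i hk
  · have hclosed : IsClosed {q : ConstraintSpace l₁ l₂ l |
        (q.snd.fst i ≤ 0 ∧ q.snd.snd i ≤ 0) ∨ q.snd.fst i * q.snd.snd i = 0} :=
      ((isClosed_le (continuous_snd_fst i) continuous_const).inter
        (isClosed_le (continuous_snd_snd i) continuous_const)).union
        (isClosed_eq ((continuous_snd_fst i).mul (continuous_snd_snd i)) continuous_const)
    exact hclosed.mem_of_tendsto hps (Eventually.of_forall fun k => (h k).degenerate i)

/-- Limiting normals to the cylinder `ℝⁿ × U`. -/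
theorem limitingNormalCone_cylinder {n m : ℕ} {U : Set (Eucl m)} (hU : IsClosed U)
    {z a : EuclProd n m} (ha : a ∈ limitingNormalCone {z : EuclProd n m | z.snd ∈ U} z) :
    a.fst = 0 ∧ a.snd ∈ limitingNormalCone U z.snd := by
  have hD : IsClosed {z : EuclProd n m | z.snd ∈ U} :=
    hU.preimage (WithLp.continuous_snd _ _ _)
  obtain ⟨zs, as, hz, ha, h⟩ := ha
  have hmem : ∀ k, (zs k).snd ∈ U := fun k => by
    have := (h k).1
    rwa [hD.closure_eq] at this
  -- The cylinder is free in x, so the x-part of the normal is itself a feasible direction and its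
  -- squared norm is nonpositive.
  have h1 : ∀ k, (as k).fst = 0 := fun k => by
    have := inner_nonpos_of_feasible_direction (e := WithLp.toLp 2 ((as k).fst, 0)) (h k) one_pos
      (fun s _ _ => by simpa using hmem k)
    simpa [WithLp.prod_inner_apply] using this
  have h2 : ∀ k, (as k).snd ∈ proximalNormalCone U (zs k).snd := fun k => by
    obtain ⟨-, σ, hσ, hk⟩ := h k
    refine ⟨subset_closure (hmem k), σ, hσ, fun u hu => ?_⟩
    have h3 := hk (WithLp.toLp 2 ((zs k).fst, u)) hu
    rw [WithLp.prod_norm_sq_eq_of_L2, WithLp.prod_inner_apply] at h3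
    simpa using h3
  refine ⟨?_, fun k => (zs k).snd, fun k => (as k).snd,
    ((WithLp.continuous_snd _ _ _).tendsto _).comp hz,
    ((WithLp.continuous_snd _ _ _).tendsto _).comp ha, h2⟩
  refine tendsto_nhds_unique (((WithLp.continuous_fst _ _ _).tendsto _).comp ha) ?_
  exact tendsto_const_nhds.congr fun k => (h1 k).symm

end ConeNormals

/-! ### Translation between the stacked system and the original data. -/

section StackedConstraints

open ContinuousLinearMap (adjoint)

variable {n m l₁ l₂ l : ℕ}

/-- The four constraint maps stacked into one. -/
def stackMap {Z : Type*} (g : Z → Eucl l₁) (h : Z → Eucl l₂) (G H : Z → Eucl l) (z : Z) :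
    ConstraintSpace l₁ l₂ l :=
  WithLp.toLp 2 (WithLp.toLp 2 (g z, h z), WithLp.toLp 2 (G z, H z))

/-- Compare with the cone point (a - a₊, 0, d), where d is a nearest complementary pair to c. -/
theorem infDist_constraintCone_le (a : Eucl l₁) (b : Eucl l₂) (c : EuclProd l l) :
    Metric.infDist (WithLp.toLp 2 (WithLp.toLp 2 (a, b), c)) (constraintCone l₁ l₂ l) ≤
      ‖posPartVec a‖ + ‖b‖ + Metric.infDist c (complementarityCone l) := by
  obtain ⟨d, hd, hcd⟩ := (isClosed_complementarityCone l).exists_infDist_eq_dist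
    ⟨0, mem_complementarityCone_iff.2 fun i => by simp⟩ c
  have hmem : (WithLp.toLp 2 (WithLp.toLp 2 (a - posPartVec a, 0), d) :
      ConstraintSpace l₁ l₂ l) ∈ constraintCone l₁ l₂ l :=
    ⟨fun i => by simp [posPartVec], rfl, hd⟩
  refine (Metric.infDist_le_dist_of_mem hmem).trans ?_
  rw [hcd, dist_eq_norm, dist_eq_norm]
  refine (norm_le_norm_fst_add_norm_snd _).trans ?_
  refine add_le_add ((norm_le_norm_fst_add_norm_snd _).trans ?_) le_rfl
  simp

theorem HasStrictFDerivAt.self_fderiv {E F : Type*} [NormedAddCommGroup E] [NormedSpace ℝ E]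
    [NormedAddCommGroup F] [NormedSpace ℝ F] {f : E → F} {f' : E →L[ℝ] F} {z : E}
    (h : HasStrictFDerivAt f f' z) : HasStrictFDerivAt f (fderiv ℝ f z) z := by
  rwa [h.hasFDerivAt.fderiv]

theorem exists_hasStrictFDerivAt_toLp {E E₁ E₂ : Type*} [NormedAddCommGroup E] [NormedSpace ℝ E]
    [NormedAddCommGroup E₁] [NormedSpace ℝ E₁] [NormedAddCommGroup E₂] [NormedSpace ℝ E₂]
    {f₁ : E → E₁} {f₂ : E → E₂} {f₁' : E →L[ℝ] E₁} {f₂' : E →L[ℝ] E₂} {z : E}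
    (h₁ : HasStrictFDerivAt f₁ f₁' z) (h₂ : HasStrictFDerivAt f₂ f₂' z) :
    ∃ A : E →L[ℝ] WithLp 2 (E₁ × E₂), HasStrictFDerivAt (fun z => WithLp.toLp 2 (f₁ z, f₂ z)) A z :=
  ⟨_, (WithLp.prodContinuousLinearEquiv 2 ℝ E₁ E₂).symm.hasStrictFDerivAt.comp z (h₁.prodMk h₂)⟩

theorem hasStrictFDerivAt_stackMap {E : Type*} [NormedAddCommGroup E] [NormedSpace ℝ E]
    {g : E → Eucl l₁} {h : E → Eucl l₂} {G H : E → Eucl l} {z : E}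
    (hg : ∃ g' : E →L[ℝ] Eucl l₁, HasStrictFDerivAt g g' z)
    (hh : ∃ h' : E →L[ℝ] Eucl l₂, HasStrictFDerivAt h h' z)
    (hG : ∃ G' : E →L[ℝ] Eucl l, HasStrictFDerivAt G G' z)
    (hH : ∃ H' : E →L[ℝ] Eucl l, HasStrictFDerivAt H H' z) :
    HasStrictFDerivAt (stackMap g h G H) (fderiv ℝ (stackMap g h G H) z) z := by
  obtain ⟨g', hg'⟩ := hg
  obtain ⟨h', hh'⟩ := hh
  obtain ⟨G', hG'⟩ := hG
  obtain ⟨H', hH'⟩ := hH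
  obtain ⟨A, hA⟩ := exists_hasStrictFDerivAt_toLp hg' hh'
  obtain ⟨B, hB⟩ := exists_hasStrictFDerivAt_toLp hG' hH'
  obtain ⟨C, hC⟩ := exists_hasStrictFDerivAt_toLp hA hB
  have hC' : HasStrictFDerivAt (stackMap g h G H) C z := hC
  exact hC'.self_fderiv

/-- The inclusion `x ↦ (x, 0)`. -/
noncomputable def inclFst (n m : ℕ) : Eucl n →L[ℝ] EuclProd n m :=
  (WithLp.prodContinuousLinearEquiv 2 ℝ (Eucl n) (Eucl m)).symm.toContinuousLinearMap.comp
    (ContinuousLinearMap.inl ℝ (Eucl n) (Eucl m))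

/-- The inclusion `u ↦ (0, u)`. -/
noncomputable def inclSnd (n m : ℕ) : Eucl m →L[ℝ] EuclProd n m :=
  (WithLp.prodContinuousLinearEquiv 2 ℝ (Eucl n) (Eucl m)).symm.toContinuousLinearMap.comp
    (ContinuousLinearMap.inr ℝ (Eucl n) (Eucl m))

@[simp]
theorem inclFst_apply (x : Eucl n) : inclFst n m x = WithLp.toLp 2 (x, 0) := rfl

@[simp]
theorem inclSnd_apply (u : Eucl m) : inclSnd n m u = WithLp.toLp 2 (0, u) := rfl

theorem hasFDerivAt_pair_left (x : Eucl n) (u : Eucl m) :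
    HasFDerivAt (fun x' => (WithLp.toLp 2 (x', u) : EuclProd n m)) (inclFst n m) x := by
  have h : (fun x' => (WithLp.toLp 2 (x', u) : EuclProd n m)) =
      fun x' => inclFst n m x' + WithLp.toLp 2 (0, u) := by
    funext x'; rw [inclFst_apply, ← WithLp.toLp_add]; simp
  rw [h]
  exact (inclFst n m).hasFDerivAt.add_const _

theorem hasFDerivAt_pair_right (x : Eucl n) (u : Eucl m) :
    HasFDerivAt (fun u' => (WithLp.toLp 2 (x, u') : EuclProd n m)) (inclSnd n m) u := by
  have h : (fun u' => (WithLp.toLp 2 (x, u') : EuclProd n m)) =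
      fun u' => inclSnd n m u' + WithLp.toLp 2 (x, 0) := by
    funext u'; rw [inclSnd_apply, ← WithLp.toLp_add]; simp
  rw [h]
  exact (inclSnd n m).hasFDerivAt.add_const _

/-- A partial Lipschitz constant bounds the partial derivative; it is nonnegative as `0 < n`. -/
theorem partial_deriv_bound {d : ℕ} (hn : 0 < n) {f : Eucl n → Eucl m → Eucl d}
    {A : EuclProd n m →L[ℝ] Eucl d} {x : Eucl n} {u : Eucl m}
    (hf : HasFDerivAt (onPairs f) A (WithLp.toLp 2 (x, u))) {k : ℝ}
    (hL : ∃ δ : ℝ, 0 < δ ∧ ∀ x₁ ∈ Metric.ball x δ, ∀ x₂ ∈ Metric.ball x δ,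
      ‖f x₁ u - f x₂ u‖ ≤ k * ‖x₁ - x₂‖) :
    0 ≤ k ∧ ∀ v, ‖A (WithLp.toLp 2 (v, 0))‖ ≤ k * ‖v‖ := by
  obtain ⟨δ, hδ, hL⟩ := hL
  have hk : 0 ≤ k := by
    set e : Eucl n := EuclideanSpace.single ⟨0, hn⟩ (δ / 2) with he
    have hne : ‖e‖ = δ / 2 := by simp [he, abs_of_pos hδ]
    have h1 := hL (x + e) (by rw [Metric.mem_ball, dist_eq_norm]; simp [hne, hδ]) x
      (Metric.mem_ball_self hδ)
    rw [add_sub_cancel_left, hne] at h1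
    exact nonneg_of_mul_nonneg_left ((norm_nonneg _).trans h1) (half_pos hδ)
  have h1 : HasFDerivAt (fun x' => f x' u) (A.comp (inclFst n m)) x :=
    HasFDerivAt.comp x (g := onPairs f) hf (hasFDerivAt_pair_left x u)
  have h2 : ‖A.comp (inclFst n m)‖ ≤ k := by
    refine h1.le_of_lip' hk ?_
    filter_upwards [Metric.ball_mem_nhds x hδ] with x' hx'
    exact hL x' hx' x (Metric.mem_ball_self hδ)
  exact ⟨hk, fun v => (A.comp (inclFst n m)).le_of_opNorm_le h2 v⟩

namespace MixedConstraints

variable (P : MixedConstraints n m l₁ l₂ l)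

/-- The stacked constraint map at time `t`. -/
def stacked (t : ℝ) : EuclProd n m → ConstraintSpace l₁ l₂ l :=
  stackMap (onPairs (P.g t)) (onPairs (P.h t)) (onPairs (P.G t)) (onPairs (P.H t))

/-- With μ and ν the negated components of p, Ψ becomes ⟪p, F⟫. -/
theorem gradUPsi_eq {t : ℝ} {z : EuclProd n m} {A : EuclProd n m →L[ℝ] ConstraintSpace l₁ l₂ l}
    (hA : HasFDerivAt (P.stacked t) A z) (p : ConstraintSpace l₁ l₂ l) :
    P.gradUPsi t z.fst z.snd p.fst.fst p.fst.snd (-p.snd.fst) (-p.snd.snd) =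
      (adjoint A p).snd := by
  have h1 : (fun v => P.Psi t z.fst v p.fst.fst p.fst.snd (-p.snd.fst) (-p.snd.snd)) =
      fun v => ⟪p, P.stacked t (WithLp.toLp 2 (z.fst, v))⟫ := by
    funext v
    rw [real_inner_comm]
    simp only [Psi, stacked, stackMap, onPairs, WithLp.prod_inner_apply, inner_neg_right,
      WithLp.ofLp_fst, WithLp.ofLp_snd, WithLp.toLp_fst, WithLp.toLp_snd]
    ring
  have h2 : HasFDerivAt (fun v => P.stacked t (WithLp.toLp 2 (z.fst, v)))
      (A.comp (inclSnd n m)) z.snd :=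
    HasFDerivAt.comp z.snd (g := P.stacked t) hA (hasFDerivAt_pair_right z.fst z.snd)
  have h3 := (innerSL ℝ p).hasFDerivAt.comp z.snd h2
  rw [gradUPsi, h1]
  refine HasGradientAt.gradient (hasGradientAt_iff_hasFDerivAt.2 (h3.congr_fderiv ?_))
  ext v
  simp [← ContinuousLinearMap.adjoint_inner_left, WithLp.prod_inner_apply]

theorem admissibleMultipliers_of_isConeNormal {t : ℝ} {z : EuclProd n m}
    {p : ConstraintSpace l₁ l₂ l} (hp : IsConeNormal (P.stacked t z) p) :
    P.AdmissibleMultipliers t z.fst z.snd p.fst.fst (-p.snd.fst) (-p.snd.snd) where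
  lam_nonneg := hp.nonneg
  lam_inactive := hp.inactive
  mu_eq_zero i hi _ := by simpa using hp.fst_eq_zero i hi
  nu_eq_zero i _ hi := by simpa using hp.snd_eq_zero i hi
  degenerate i _ _ := by
    -- Weak inequalities are either both strict, giving positive multipliers, or one is an equality
    -- and the product vanishes.
    rcases hp.degenerate i with ⟨h1, h2⟩ | h
    · rcases h1.lt_or_eq with h1 | h1
      · rcases h2.lt_or_eq with h2 | h2
        · left; simp [h1, h2]
        · right; simp [h2]
      · right; simp [h1]
    · right; simpa using h

theorem norm_eq_sqrt (p : ConstraintSpace l₁ l₂ l) :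
    √(‖p.fst.fst‖ ^ 2 + ‖p.fst.snd‖ ^ 2 + ‖-p.snd.fst‖ ^ 2 + ‖-p.snd.snd‖ ^ 2) = ‖p‖ := by
  rw [Real.sqrt_eq_iff_mul_self_eq (by positivity) (norm_nonneg _), ← sq,
    WithLp.prod_norm_sq_eq_of_L2, WithLp.prod_norm_sq_eq_of_L2, WithLp.prod_norm_sq_eq_of_L2,
    norm_neg, norm_neg]
  ring

/-- The multiplier bound at the fixed point `z`, expressed with the stacked constraints. -/
theorem norm_le_of_multiplierBound {t : ℝ} {z : EuclProd n m}
    {A : EuclProd n m →L[ℝ] ConstraintSpace l₁ l₂ l} (hU : IsClosed (P.U t))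
    (hA : HasFDerivAt (P.stacked t) A z) {κ : ℝ}
    (hM : ∀ ζ ∈ limitingNormalCone (P.U t) z.snd,
      ∀ (lam : Eucl l₁) (ups : Eucl l₂) (mu nu : Eucl l),
      P.AdmissibleMultipliers t z.fst z.snd lam mu nu →
        √(‖lam‖ ^ 2 + ‖ups‖ ^ 2 + ‖mu‖ ^ 2 + ‖nu‖ ^ 2) ≤
          κ * ‖P.gradUPsi t z.fst z.snd lam ups mu nu + ζ‖)
    {p : ConstraintSpace l₁ l₂ l}
    (hp : p ∈ limitingNormalCone (constraintCone l₁ l₂ l) (P.stacked t z)) {a : EuclProd n m}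
    (ha : a - adjoint A p ∈ limitingNormalCone (P.D t) z) :
    a.fst = (adjoint A p).fst ∧ ‖p‖ ≤ κ * ‖a.snd‖ := by
  obtain ⟨h1, h2⟩ := limitingNormalCone_cylinder hU ha
  refine ⟨sub_eq_zero.1 h1, ?_⟩
  -- Here ζ is the u-part of a - A*p, so adding it to ∇ᵤΨ leaves exactly the u-part of a.
  have h3 := hM _ h2 _ p.fst.snd _ _
    (P.admissibleMultipliers_of_isConeNormal (isConeNormal_of_mem_limitingNormalCone hp))
  rw [norm_eq_sqrt, P.gradUPsi_eq hA p, WithLp.sub_snd, add_sub_cancel] at h3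
  exact h3

/-- Write α for the x-part of A*p. Then ‖α‖² = ⟪p, A(α, 0)⟫, which involves only the partial
derivative in x. -/
theorem norm_adjoint_fst_le {A : EuclProd n m →L[ℝ] ConstraintSpace l₁ l₂ l} {kg kh kG kH : ℝ}
    (hkg : 0 ≤ kg) (hkh : 0 ≤ kh) (hkG : 0 ≤ kG) (hkH : 0 ≤ kH)
    (hg : ∀ v, ‖(A (WithLp.toLp 2 (v, 0))).fst.fst‖ ≤ kg * ‖v‖)
    (hh : ∀ v, ‖(A (WithLp.toLp 2 (v, 0))).fst.snd‖ ≤ kh * ‖v‖)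
    (hG : ∀ v, ‖(A (WithLp.toLp 2 (v, 0))).snd.fst‖ ≤ kG * ‖v‖)
    (hH : ∀ v, ‖(A (WithLp.toLp 2 (v, 0))).snd.snd‖ ≤ kH * ‖v‖)
    (p : ConstraintSpace l₁ l₂ l) :
    ‖(adjoint A p).fst‖ ≤ (kg + kh + kG + kH) * ‖p‖ := by
  set α := (adjoint A p).fst with hα
  rcases (norm_nonneg α).eq_or_lt with h0 | h0
  · rw [← h0]; positivity
  have h1 : ‖α‖ ^ 2 = ⟪p, A (WithLp.toLp 2 (α, 0))⟫ := by
    rw [← ContinuousLinearMap.adjoint_inner_left, WithLp.prod_inner_apply]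
    simp [hα]
  have hc : ‖A (WithLp.toLp 2 (α, 0))‖ ≤ (kg + kh + kG + kH) * ‖α‖ := by
    have h2 := norm_le_norm_fst_add_norm_snd (A (WithLp.toLp 2 (α, 0)))
    have h3 := norm_le_norm_fst_add_norm_snd (A (WithLp.toLp 2 (α, 0))).fst
    have h4 := norm_le_norm_fst_add_norm_snd (A (WithLp.toLp 2 (α, 0))).snd
    linarith [hg α, hh α, hG α, hH α]
  have h2 := (real_inner_le_norm p (A (WithLp.toLp 2 (α, 0)))).trans
    (mul_le_mul_of_nonneg_left hc (norm_nonneg p))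
  rw [← h1] at h2
  refine le_of_mul_le_mul_right (a := ‖α‖) ?_ h0
  linarith

end MixedConstraints

end StackedConstraints

/-! ### The error bound and bounded slope conditions. -/

theorem mainTheorem8 {n m l₁ l₂ l : ℕ} (hn : 0 < n) (P : MixedConstraints n m l₁ l₂ l)
    (t₀ t₁ : ℝ) (xs : ℝ → Eucl n) (us : ℝ → Eucl m) (ε : ℝ) (R : ℝ → ℝ≥0∞)
    (hU : ∀ t ∈ Set.Icc t₀ t₁, IsClosed (P.U t))
    (hg : ∀ t ∈ Set.Icc t₀ t₁, StrictlyDifferentiable (P.g t))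
    (hh : ∀ t ∈ Set.Icc t₀ t₁, StrictlyDifferentiable (P.h t))
    (hG : ∀ t ∈ Set.Icc t₀ t₁, StrictlyDifferentiable (P.G t))
    (hH : ∀ t ∈ Set.Icc t₀ t₁, StrictlyDifferentiable (P.H t))
    (kg kh kG kH κ : ℝ → ℝ)
    (hkg : AEMeasurable kg (volume.restrict (Set.Icc t₀ t₁)))
    (hkh : AEMeasurable kh (volume.restrict (Set.Icc t₀ t₁)))
    (hkG : AEMeasurable kG (volume.restrict (Set.Icc t₀ t₁)))
    (hkH : AEMeasurable kH (volume.restrict (Set.Icc t₀ t₁)))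
    (hκ : AEMeasurable κ (volume.restrict (Set.Icc t₀ t₁)))
    (hLg : P.LipschitzInX P.g t₀ t₁ xs us ε R kg)
    (hLh : P.LipschitzInX P.h t₀ t₁ xs us ε R kh)
    (hLG : P.LipschitzInX P.G t₀ t₁ xs us ε R kG)
    (hLH : P.LipschitzInX P.H t₀ t₁ xs us ε R kH)
    (hM : P.MultiplierBound t₀ t₁ xs us ε R κ) :
    (∀ᵐ t ∂volume.restrict (Set.Icc t₀ t₁), ∀ z ∈ P.SStar xs us ε R t, P.ErrorBoundAt t z) ∧
    AEMeasurable (fun t => κ t * (kg t + kh t + kG t + kH t))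
      (volume.restrict (Set.Icc t₀ t₁)) ∧
    P.BoundedSlope t₀ t₁ xs us ε R (fun t => κ t * (kg t + kh t + kG t + kH t)) := by
  have hmem : ∀ᵐ t ∂volume.restrict (Set.Icc t₀ t₁), t ∈ Set.Icc t₀ t₁ :=
    ae_restrict_mem measurableSet_Icc
  have hF : ∀ t ∈ Set.Icc t₀ t₁, ∀ z,
      HasStrictFDerivAt (P.stacked t) (fderiv ℝ (P.stacked t) z) z := fun t ht z =>
    hasStrictFDerivAt_stackMap (hg t ht z) (hh t ht z) (hG t ht z) (hH t ht z)
  have hCQ : ∀ᵐ t ∂volume.restrict (Set.Icc t₀ t₁), ∀ z ∈ P.SStar xs us ε R t,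
      ∀ p ∈ limitingNormalCone (constraintCone l₁ l₂ l) (P.stacked t z),
        ∀ a : EuclProd n m,
          a - ContinuousLinearMap.adjoint (fderiv ℝ (P.stacked t) z) p ∈
            limitingNormalCone (P.D t) z →
          a.fst = (ContinuousLinearMap.adjoint (fderiv ℝ (P.stacked t) z) p).fst ∧
            ‖p‖ ≤ κ t * ‖a.snd‖ := by
    filter_upwards [hmem, hM] with t ht hMt z hz p hp a ha
    exact P.norm_le_of_multiplierBound (hU t ht) (hF t ht z).hasFDerivAt (hMt z.fst z.snd hz) hp ha
  have hCQ' : ∀ᵐ t ∂volume.restrict (Set.Icc t₀ t₁), ∀ z ∈ P.SStar xs us ε R t,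
      ∀ p ∈ limitingNormalCone (constraintCone l₁ l₂ l) (P.stacked t z),
        -ContinuousLinearMap.adjoint (fderiv ℝ (P.stacked t) z) p ∈
            limitingNormalCone (P.D t) z → p = 0 := by
    filter_upwards [hCQ] with t hCQt z hz p hp hpD
    have := (hCQt z hz p hp 0 (by rwa [zero_sub])).2
    simpa using this
  have hD : ∀ t ∈ Set.Icc t₀ t₁, IsClosed (P.D t) := fun t ht =>
    (hU t ht).preimage (WithLp.continuous_snd _ _ _)
  refine ⟨?_, hκ.mul (((hkg.add hkh).add hkG).add hkH), ?_⟩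
  · filter_upwards [hmem, hCQ'] with t ht hCQt z hz
    refine ⟨hz.1, ?_⟩
    obtain ⟨τ, hτ, δ, hδ, hb⟩ := exists_errorBound (hD t ht) isClosed_constraintCone
      (hF t ht) hz.1.2 (hCQt z hz)
    exact ⟨τ, hτ, δ, hδ, fun x hx => (hb x hx).trans
      (mul_le_mul_of_nonneg_left (infDist_constraintCone_le _ _ _) hτ.le)⟩
  · filter_upwards [hmem, hCQ, hCQ', hLg, hLh, hLG, hLH] with t ht hCQt hCQt' hLgt hLht hLGt hLHt
      z hz α β hαβ
    obtain ⟨p, hp, hpD⟩ := exists_multiplier_of_mem_proximalNormalCone (hD t ht)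
      isClosed_constraintCone (hF t ht) hz.1.1 hz.1.2 (hCQt' z hz) hαβ
    obtain ⟨h1, h2⟩ := hCQt z hz p hp _ hpD
    have hFz := (hF t ht z).hasFDerivAt
    have hd1 := (WithLp.fstL 2 ℝ (EuclProd l₁ l₂) (EuclProd l l)).hasFDerivAt.comp z hFz
    have hd2 := (WithLp.sndL 2 ℝ (EuclProd l₁ l₂) (EuclProd l l)).hasFDerivAt.comp z hFz
    obtain ⟨hkg0, hgb⟩ := partial_deriv_bound hn (f := P.g t) (x := z.fst) (u := z.snd)
      ((WithLp.fstL 2 ℝ (Eucl l₁) (Eucl l₂)).hasFDerivAt.comp z hd1) (hLgt z.fst z.snd hz)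
    obtain ⟨hkh0, hhb⟩ := partial_deriv_bound hn (f := P.h t) (x := z.fst) (u := z.snd)
      ((WithLp.sndL 2 ℝ (Eucl l₁) (Eucl l₂)).hasFDerivAt.comp z hd1) (hLht z.fst z.snd hz)
    obtain ⟨hkG0, hGb⟩ := partial_deriv_bound hn (f := P.G t) (x := z.fst) (u := z.snd)
      ((WithLp.fstL 2 ℝ (Eucl l) (Eucl l)).hasFDerivAt.comp z hd2) (hLGt z.fst z.snd hz)
    obtain ⟨hkH0, hHb⟩ := partial_deriv_bound hn (f := P.H t) (x := z.fst) (u := z.snd)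
      ((WithLp.sndL 2 ℝ (Eucl l) (Eucl l)).hasFDerivAt.comp z hd2) (hLHt z.fst z.snd hz)
    have h3 := MixedConstraints.norm_adjoint_fst_le hkg0 hkh0 hkG0 hkH0 hgb hhb hGb hHb p
    have h4 : ‖α‖ ≤ (kg t + kh t + kG t + kH t) * ‖p‖ := by
      have : α = _ := h1
      rw [this]
      exact h3
    have h5 := mul_le_mul_of_nonneg_left h2
      (by positivity : 0 ≤ kg t + kh t + kG t + kH t)
    calc ‖α‖ ≤ (kg t + kh t + kG t + kH t) * (κ t * ‖β‖) := h4.trans h5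
      _ = κ t * (kg t + kh t + kG t + kH t) * ‖β‖ := by ring
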